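/- **Setting.** Let $d\in\mathbb N_0$. For $0\le m\le n$ let $P_n^m(x)=(-1)^m(1-x^2)^{m/2}\frac{d^m}{dx^m}P_n(x)$ be the associated Legendre function, where $P_n$ is the $n$th Legendre polynomial. Define the real spherical harmonics $Y_n^0(\theta,\phi)=\sqrt{2n+1}\,P_n(\cos\theta)$ and, for $1\le |m|\le n$, $$Y_n^m(\theta,\phi)=\sqrt{2(2n+1)\tfrac{(n-|m|)!}{(n+|m|)!}}\;P_n^{|m|}(\cos\theta)\cdot\begin{cases}\cos(m\phi),&m>0,\\ \sin(m\phi),&m<0.\end{cases}$$ Let $f_d=(Y_\ell^m)_{0\le \ell\le d,\,-\ell\le m\le \ell}\in\mathbb R^{(d+1)^2}$. A *design* is a Borel probability measure $\xi$ on $[0,\pi]\times(-\pi,\pi]$, and its information matrix is $M(\xi)=\int f_d f_d^T\,d\xi$. For $0\le k_0<\dots<k_q\le d$ let $K=K_{k_0,\dots,k_q}$ be the $0/1$ matrix with $(d+1)^2$ rows such that $K^Tc$ is the vector of the coefficients $c_{k_i}^m$, $0\le i\le q$, $-k_i\le m\le k_i$, of $c=(c_\ell^m)$. The vector $K^Tc$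 is *estimable* by $\xi$ if $\operatorname{range}K\subseteq\operatorname{range}M(\xi)$. For $p\in[-\infty,1)$, a design is *$\Phi_p$-optimal for $K^Tc$* if $K^Tc$ is estimable by it and it maximizes, among all designs by which $K^Tc$ is estimable, $$\Phi_p(\xi)=\bigl(\operatorname{tr}(K^TM^-(\xi)K)^{-p}\bigr)^{1/p}\quad(p\ne0,-\infty),$$ $$\Phi_0(\xi)=\det(K^TM^-(\xi)K)^{-1},\qquad \Phi_{-\infty}(\xi)=\lambda_{\min}\bigl((K^TM^-(\xi)K)^{-1}\bigr),$$ where $M^-$ is a generalized inverse of $M$ (that is, $MM^-M=M$). For $1\le s\le(d+1)^2$, a design is *$\Psi_{p,s}$-optimal* if it maximizes, among all designs, $$\Psi_{p,s}(\xi)=\Bigl(\sum_{j=1}^s\lambda_{(j)}(M(\xi))^p\Bigr)^{1/p}\quad(p\neq0,-\infty),$$ $$\Psi_{0,s}(\xi)=\prod_{j=1}^s\lambda_{(j)}(M(\xi)),\qquad \Psi_{-\infty,s}(\xi)=\lambda_{(1)}(M(\xi)),$$ where $\lambda_{(j)}(M)$ is the $j$th smallest eigenvalue of $M$, with multiplicity;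 for $p<0$ the value is $0$ if $\lambda_{(1)}(M(\xi))=0$. **Theorem 3.2.** Let $r\in\{d+1,\dots,2d\}$, let $-1\le x_1<\dots<x_r\le1$ and $w_1,\dots,w_r>0$ satisfy $$\sum_{i=1}^r w_ix_i^\ell=\tfrac12\int_{-1}^1x^\ell\,dx,\qquad \ell=0,\dots,2d,$$ and let $\mu$ be the probability measure with mass $w_i$ at $\theta_i=\arccos x_i$. Let $t\ge 2d+1$ be an integer and $\alpha\in(-\frac{t+1}{t}\pi,-\pi]$, and let $\nu$ be the probability measure with mass $1/t$ at each $\phi_j=\alpha+\frac{2\pi j}{t}$, $j=1,\dots,t$. Then: 1. $M(\mu\otimes\nu)=I_{(d+1)^2}$; 2. $\mu\otimes\nu$ is a $\Phi_p$-optimal design for $K_{k_0,\dots,k_q}^Tc$, for every $p\in[-\infty,1)$ and all $0\le k_0<\dots<k_q\le d$; 3. $\mu\otimes\nu$ is a $\Psi_{p,s}$-optimal design, for every $p\in[-\infty,1)$ and every $1\le s\le(d+1)^2$. -/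

import Mathlib

open MeasureTheory

noncomputable section

namespace SphericalDesign

/-- The Legendre polynomial `P_n`, by Rodrigues' formula
`P_n = (1 / (2^n n!)) (d/dX)^n (X^2 - 1)^n`. -/
def legendreP (n : ℕ) : Polynomial ℝ :=
  Polynomial.C (1 / (2 ^ n * (n.factorial : ℝ))) *
    Polynomial.derivative^[n] ((Polynomial.X ^ 2 - 1) ^ n)

/-- The associated Legendre function
`P_n^m(x) = (-1)^m (1 - x^2)^{m/2} (d/dx)^m P_n(x)` on `[-1, 1]`, for `0 ≤ m ≤ n`. -/
def assocLegendre (n m : ℕ) (x : ℝ) : ℝ :=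
  (-1) ^ m * (√(1 - x ^ 2)) ^ m * (Polynomial.derivative^[m] (legendreP n)).eval x

/-- The real spherical harmonic `Y_n^m`, `|m| ≤ n`, at polar angle `θ` and azimuth `φ`,
scaled to have mean square one on the sphere. -/
def sphHarm (n : ℕ) (m : ℤ) (θ φ : ℝ) : ℝ :=
  if m = 0 then √(2 * n + 1) * assocLegendre n 0 (Real.cos θ)
  else
    √(2 * (2 * n + 1) * (((n - m.natAbs).factorial : ℝ) / ((n + m.natAbs).factorial : ℝ))) *
      assocLegendre n m.natAbs (Real.cos θ) *
      (if 0 < m then Real.cos (m * φ) else Real.sin (m * φ))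

/-- Indices of the harmonics of degree `ℓ`: the integers `-ℓ, …, ℓ`. -/
abbrev Order (ℓ : ℕ) : Type := {m : ℤ // m ∈ Finset.Icc (-(ℓ : ℤ)) (ℓ : ℤ)}

/-- Indices `(ℓ, m)`, `0 ≤ ℓ ≤ d`, `-ℓ ≤ m ≤ ℓ`, of the model of order `d`. -/
abbrev Idx (d : ℕ) : Type := Σ ℓ : Fin (d + 1), Order (ℓ : ℕ)

theorem card_order (ℓ : ℕ) : Fintype.card (Order ℓ) = 2 * ℓ + 1 := by
  rw [Fintype.card_coe, Int.card_Icc]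
  omega

theorem card_idx (d : ℕ) : Fintype.card (Idx d) = (d + 1) ^ 2 := by
  rw [Fintype.card_sigma]
  simp only [card_order]
  rw [Fin.sum_univ_eq_sum_range (fun i => 2 * i + 1) (d + 1)]
  induction d with
  | zero => rfl
  | succ n ih => rw [Finset.sum_range_succ, ih]; ring

/-- The vector of regression functions `f_d(θ, φ)`. -/
def regressionVec (d : ℕ) (z : ℝ × ℝ) (a : Idx d) : ℝ :=
  sphHarm (a.1 : ℕ) (a.2 : ℤ) z.1 z.2

/-- An approximate design: a probability measure on `[0, π] × (-π, π]`, regarded as a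
Borel measure on the plane that is concentrated on this rectangle. -/
structure IsDesign (ξ : Measure (ℝ × ℝ)) : Prop where
  prob : IsProbabilityMeasure ξ
  concentrated : ξ (Set.Icc 0 Real.pi ×ˢ Set.Ioc (-Real.pi) Real.pi)ᶜ = 0

/-- The information matrix `M(ξ) = ∫ f_d f_dᵀ dξ`. -/
def infoMatrix (d : ℕ) (ξ : Measure (ℝ × ℝ)) : Matrix (Idx d) (Idx d) ℝ :=
  Matrix.of fun a b => ∫ z, regressionVec d z a * regressionVec d z b ∂ξ

theorem infoMatrix_isHermitian (d : ℕ) (ξ : Measure (ℝ × ℝ)) :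
    (infoMatrix d ξ).IsHermitian := by
  ext a b
  simp [infoMatrix, Matrix.conjTranspose_apply, mul_comm]

/-- The matrix `K` with block columns `i = 0, …, q`; the `i`-th one has the identity matrix of
size `2 k_i + 1` in the rows of degree `k_i` and zeros elsewhere. So `Kᵀ c` lists the
coefficients `c_{k_i}^m`. -/
def selectMatrix {d q : ℕ} (k : Fin (q + 1) → Fin (d + 1)) :
    Matrix (Idx d) (Σ i : Fin (q + 1), Order (k i : ℕ)) ℝ :=
  Matrix.of fun a b => if a = ⟨k b.1, b.2⟩ then 1 else 0

theorem exists_genInv {n : Type*} [Fintype n] [DecidableEq n] (A : Matrix n n ℝ) :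
    ∃ G : Matrix n n ℝ, A * G * A = A := by
  obtain ⟨g, hg⟩ := LinearMap.exists_rightInverse_of_surjective
    (Matrix.toLin' A).rangeRestrict (LinearMap.range_rangeRestrict _)
  obtain ⟨g', hg'⟩ := LinearMap.exists_extend g
  refine ⟨LinearMap.toMatrix' g', ?_⟩
  apply (Matrix.toLin' (R := ℝ)).injective
  refine LinearMap.ext fun v => ?_
  rw [Matrix.toLin'_mul, Matrix.toLin'_mul, Matrix.toLin'_toMatrix']
  have h1 := fun y => LinearMap.congr_fun hg' y
  have h2 := fun y => LinearMap.congr_fun hg y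
  simp only [LinearMap.comp_apply, Submodule.subtype_apply, LinearMap.id_apply] at h1 h2
  have h3 := h1 ((Matrix.toLin' A).rangeRestrict v)
  have h4 := congrArg Subtype.val (h2 ((Matrix.toLin' A).rangeRestrict v))
  rw [← h3] at h4
  exact h4

/-- A generalized inverse `A⁻` of `A`, that is, a matrix with `A A⁻ A = A`. The matrix
`Kᵀ A⁻ K` does not depend on the choice if `A` is symmetric and `range K ⊆ range A`. -/
def genInv {n : Type*} [Fintype n] [DecidableEq n] (A : Matrix n n ℝ) : Matrix n n ℝ :=
  (exists_genInv A).choose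

/-- `Kᵀ c` is estimable by `ξ`: `range K ⊆ range M(ξ)`. -/
def Estimable {d : ℕ} {ι : Type*} [Fintype ι] (K : Matrix (Idx d) ι ℝ)
    (ξ : Measure (ℝ × ℝ)) : Prop :=
  LinearMap.range K.mulVecLin ≤ LinearMap.range (infoMatrix d ξ).mulVecLin

/-- Kiefer's criterion `Φ_p(ξ) = (tr (Kᵀ M⁻(ξ) K)^{-p})^{1/p}`, with
`Φ_0(ξ) = det (Kᵀ M⁻(ξ) K)⁻¹` and `Φ_{-∞}(ξ) = λ_min((Kᵀ M⁻(ξ) K)⁻¹)`, for `p ∈ [-∞, 1)`. The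
real power of the symmetric matrix is taken by functional calculus, and `λ_min` is the least
element of the (finite) spectrum. It is used where `Kᵀ c` is estimable and `K` has full column
rank; then `Kᵀ M⁻(ξ) K` is symmetric and positive definite. -/
def Phi {d : ℕ} {ι : Type*} [Fintype ι] [DecidableEq ι] (p : EReal) (K : Matrix (Idx d) ι ℝ)
    (ξ : Measure (ℝ × ℝ)) : ℝ :=
  let A : Matrix ι ι ℝ := K.transpose * genInv (infoMatrix d ξ) * K
  if p = ⊥ then sInf (spectrum ℝ A⁻¹)
  else if p = 0 then (A⁻¹).det
  else (cfc (fun x : ℝ => x ^ (-p.toReal)) A).trace ^ (1 / p.toReal)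

/-- `ξ` is `Φ_p`-optimal for `Kᵀ c`: it maximizes `Φ_p` among the designs for which `Kᵀ c` is
estimable. -/
def IsPhiOptimal {d : ℕ} {ι : Type*} [Fintype ι] [DecidableEq ι] (p : EReal)
    (K : Matrix (Idx d) ι ℝ) (ξ : Measure (ℝ × ℝ)) : Prop :=
  IsDesign ξ ∧ Estimable K ξ ∧
    ∀ η : Measure (ℝ × ℝ), IsDesign η → Estimable K η → Phi p K η ≤ Phi p K ξ

/-- `sortedEig d ξ j` is the `(j + 1)`-st smallest eigenvalue of `M(ξ)`, counted with
multiplicity (Mathlib's `eigenvalues₀` is in decreasing order). -/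
def sortedEig (d : ℕ) (ξ : Measure (ℝ × ℝ)) (j : Fin ((d + 1) ^ 2)) : ℝ :=
  (infoMatrix_isHermitian d ξ).eigenvalues₀ (Fin.cast (card_idx d).symm (Fin.rev j))

/-- The criterion `Ψ_{p,s}(ξ) = (∑_{j=1}^s λ_(j)(M(ξ))^p)^{1/p}`, with
`Ψ_{0,s}(ξ) = ∏_{j=1}^s λ_(j)(M(ξ))` and `Ψ_{-∞,s}(ξ) = λ_(1)(M(ξ))`, for `p ∈ [-∞, 1)`. The
eigenvalues are nonnegative; with values in `[0, ∞]`, the conventions `0^p = ∞` and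
`∞^{1/p} = 0` for `p < 0` give singular information matrices the value `0`. -/
def Psi (d : ℕ) (p : EReal) (s : ℕ) (ξ : Measure (ℝ × ℝ)) : ENNReal :=
  if p = ⊥ then ENNReal.ofReal (sortedEig d ξ ⟨0, by positivity⟩)
  else if p = 0 then
    ∏ j ∈ Finset.univ.filter (fun j : Fin ((d + 1) ^ 2) => (j : ℕ) < s), ENNReal.ofReal (sortedEig d ξ j)
  else
    (∑ j ∈ Finset.univ.filter (fun j : Fin ((d + 1) ^ 2) => (j : ℕ) < s),
      ENNReal.ofReal (sortedEig d ξ j) ^ p.toReal) ^ (1 / p.toReal)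

/-- `ξ` is `Ψ_{p,s}`-optimal: it maximizes `Ψ_{p,s}` among all designs. -/
def IsPsiOptimal (d : ℕ) (p : EReal) (s : ℕ) (ξ : Measure (ℝ × ℝ)) : Prop :=
  IsDesign ξ ∧ ∀ η : Measure (ℝ × ℝ), IsDesign η → Psi d p s η ≤ Psi d p s ξ

/-- Nodes `-1 ≤ x_1 < ⋯ < x_r ≤ 1` and positive weights `w_1, …, w_r` form a quadrature formula
of degree `z`: `∑ w_i x_i^ℓ = (1/2) ∫_{-1}^1 x^ℓ dx` for `ℓ = 0, …, z`. (The case `ℓ = 0` says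
that the weights sum to one.) -/
structure IsQuadrature (z : ℕ) {r : ℕ} (x w : Fin r → ℝ) : Prop where
  strictMono : StrictMono x
  mem_Icc : ∀ i, x i ∈ Set.Icc (-1 : ℝ) 1
  pos : ∀ i, 0 < w i
  exact : ∀ ℓ : ℕ, ℓ ≤ z → ∑ i, w i * x i ^ ℓ = 1 / 2 * ∫ y in (-1 : ℝ)..1, y ^ ℓ

/-- The design `μ` on `[0, π]` with mass `w_i` at `θ_i = arccos x_i`. -/
def polarDesign {r : ℕ} (x w : Fin r → ℝ) : Measure ℝ :=
  ∑ i, ENNReal.ofReal (w i) • Measure.dirac (Real.arccos (x i))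

/-- The design `ν(α, t)` with mass `1 / t` at each `φ_j = α + 2πj/t`, `j = 1, …, t`. -/
def azimuthDesign (α : ℝ) (t : ℕ) : Measure ℝ :=
  ∑ j : Fin t, (t : ENNReal)⁻¹ • Measure.dirac (α + 2 * Real.pi * ((j : ℕ) + 1 : ℝ) / t)

end SphericalDesign

end

open SphericalDesign

/-!
Two facts about the harmonics carry the proof.

* The addition theorem on the diagonal (`sum_sphHarm_sq`): `∑_m Y_ℓ^m(θ, φ) ^ 2 = 2 ℓ + 1` at every
  point. Hence for *every* design the block of degree `ℓ` of the information matrix has trace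
  `2 ℓ + 1`, the trace it has in the identity matrix (`sum_infoMatrix_diag`).
* Orthonormality: products of two harmonics of degree at most `d` are polynomials of degree at most
  `2 d` in `cos θ` times trigonometric polynomials of degree at most `2 d` in `φ`. The quadrature
  formula and the `t ≥ 2 d + 1` equally spaced nodes integrate these exactly, so the product design
  has the identity as information matrix (`IsQuadrature.infoMatrix_prod`).

Both come from Legendre's equation (`legendreP_ode`). By it the derivative of
`P_ℓ ^ 2 + 2 ∑_m (ℓ - m)! / (ℓ + m)! (P_ℓ^m) ^ 2` telescopes to zero
(`sum_normCoeff_assocProd`), and integration by parts reduces the inner products of the `P_n^m` to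
those of the `P_n`. The norm of `P_n` then follows by integrating the addition theorem.

All criteria are monotone functions of power means of eigenvalues with exponent less than one, and
such a mean is at most the arithmetic mean. For `Φ_p` the eigenvalues are those of
`(Kᵀ M⁻ K)⁻¹`, whose trace is at most that of `Kᵀ M K`, since
`Kᵀ M K - (Kᵀ M⁻ K)⁻¹` is positive semidefinite
(`posSemidef_sub_inv_transpose_mul_genInv_mul`). For `Ψ_{p,s}` they are the `s` smallest eigenvalues
of `M`, whose mean is at most the mean of all (`sum_filter_val_lt_le`). In both cases the arithmetic
mean is at most one for every design, by the trace identity, and the identity matrix attains the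
resulting bound.
-/

noncomputable section
namespace SphericalDesign

/-! ### Legendre's equation -/
section Legendre
open Polynomial

/-- The `(k + 1)`-fold derivative of `(X ^ 2 - 1) h' = 2 n X h` for `h = (X ^ 2 - 1) ^ n`. -/
theorem iterate_derivative_sq_sub_one_pow_ode (n k : ℕ) :
    (X ^ 2 - 1) * derivative^[k + 2] (((X : ℝ[X]) ^ 2 - 1) ^ n) +
      2 * ((k : ℝ[X]) + 1 - (n : ℝ[X])) * X * derivative^[k + 1] (((X : ℝ[X]) ^ 2 - 1) ^ n) +
      ((k : ℝ[X]) + 1) * ((k : ℝ[X]) - 2 * (n : ℝ[X])) *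
        derivative^[k] (((X : ℝ[X]) ^ 2 - 1) ^ n) = 0 := by
  induction k with
  | zero =>
    have h0 : (X ^ 2 - 1) * derivative (((X : ℝ[X]) ^ 2 - 1) ^ n) =
        2 * (n : ℝ[X]) * X * ((X : ℝ[X]) ^ 2 - 1) ^ n := by
      rcases n with _ | n
      · simp
      · rw [derivative_pow, Nat.add_sub_cancel, pow_succ _ n]
        simp
        ring
    have h1 := congrArg derivative h0
    simp only [derivative_mul, derivative_sub, derivative_X_sq, derivative_one, derivative_X,
      derivative_ofNat, derivative_natCast, map_ofNat] at h1
    simp only [Function.iterate_succ_apply', Function.iterate_zero_apply, Nat.cast_zero]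
    generalize ((X : ℝ[X]) ^ 2 - 1) ^ n = h at *
    linear_combination h1
  | succ k ih =>
    have h1 := congrArg derivative ih
    simp only [derivative_mul, derivative_sub, derivative_add, derivative_X_sq, derivative_one,
      derivative_X, derivative_ofNat, derivative_natCast, map_ofNat, derivative_zero,
      ← Function.iterate_succ_apply'] at h1
    generalize ((X : ℝ[X]) ^ 2 - 1) ^ n = h at *
    push_cast
    linear_combination h1

/-- The `m`-fold derivative of Legendre's differential equation. -/
theorem legendreP_ode (n m : ℕ) :
    (1 - X ^ 2) * derivative^[m + 2] (legendreP n) =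
      2 * ((m : ℝ[X]) + 1) * X * derivative^[m + 1] (legendreP n) -
        ((n : ℝ[X]) - (m : ℝ[X])) * ((n : ℝ[X]) + (m : ℝ[X]) + 1) *
          derivative^[m] (legendreP n) := by
  have h := iterate_derivative_sq_sub_one_pow_ode n (m + n)
  simp only [legendreP, iterate_derivative_C_mul, ← Function.iterate_add_apply]
  rw [show m + n + 2 = m + 2 + n by ring, show m + n + 1 = m + 1 + n by ring] at h
  push_cast at h
  linear_combination (-C (1 / (2 ^ n * (n.factorial : ℝ)))) * h

theorem natDegree_legendreP_le (n : ℕ) : (legendreP n).natDegree ≤ n := by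
  refine (natDegree_C_mul_le _ _).trans ((natDegree_iterate_derivative _ _).trans ?_)
  have : (((X : ℝ[X]) ^ 2 - 1) ^ n).natDegree ≤ n * 2 :=
    natDegree_pow_le_of_le n (by compute_degree)
  omega

theorem iterate_derivative_legendreP_eq_zero {n m : ℕ} (h : n < m) :
    derivative^[m] (legendreP n) = 0 :=
  iterate_derivative_eq_zero ((natDegree_legendreP_le n).trans_lt h)

theorem eval_one_legendreP (n : ℕ) : (legendreP n).eval 1 = 1 := by
  -- Each derivative of `(X - 1) ^ n (X + 1) ^ n` lowers the order of the zero at `1` by one.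
  have h : ∀ k n : ℕ, k ≤ n → ∃ q : ℝ[X], derivative^[k] (((X : ℝ[X]) ^ 2 - 1) ^ n) =
      (X - 1) ^ (n - k) * q ∧ q.eval 1 = 2 ^ n * n.descFactorial k := by
    intro k
    induction k with
    | zero =>
      intro n _
      refine ⟨(X + 1) ^ n, ?_, by norm_num⟩
      rw [Function.iterate_zero_apply, Nat.sub_zero, ← mul_pow]
      ring
    | succ k ih =>
      intro n hk
      obtain ⟨q, hq, hq1⟩ := ih n (by omega)
      obtain ⟨j, rfl⟩ : ∃ j, n = k + 1 + j := ⟨n - (k + 1), by omega⟩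
      refine ⟨((j : ℝ[X]) + 1) * q + (X - 1) * derivative q, ?_, ?_⟩
      · rw [Function.iterate_succ_apply', hq, show k + 1 + j - k = j + 1 by omega,
          show k + 1 + j - (k + 1) = j by omega]
        simp [derivative_pow]
        ring
      · simp [hq1, Nat.descFactorial_succ, show k + 1 + j - k = j + 1 by omega]
        ring
  obtain ⟨q, hq, hq1⟩ := h n n le_rfl
  rw [legendreP, hq, eval_mul, eval_mul, hq1, Nat.descFactorial_self]
  have : (n.factorial : ℝ) ≠ 0 := by positivity
  simp
  field_simp

/-! ### The addition theorem on the diagonal -/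

/-- The factor `(n - m)! / (n + m)!` of the squared normalization of `P_n^m`, for `m ≤ n`. -/
def normCoeff (n m : ℕ) : ℝ := ((n - m).factorial : ℝ) / ((n + m).factorial : ℝ)

theorem normCoeff_zero (n : ℕ) : normCoeff n 0 = 1 := by
  have : (n.factorial : ℝ) ≠ 0 := by positivity
  simp [normCoeff, this]

theorem normCoeff_pos (n m : ℕ) : 0 < normCoeff n m := by
  unfold normCoeff; positivity

theorem normCoeff_succ {n m : ℕ} (h : m < n) :
    normCoeff n (m + 1) * (((n : ℝ) - m) * (n + m + 1)) = normCoeff n m := by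
  obtain ⟨j, rfl⟩ : ∃ j, n = m + 1 + j := ⟨n - (m + 1), by omega⟩
  have h1 : m + 1 + j - m = j + 1 := by omega
  have h2 : m + 1 + j - (m + 1) = j := by omega
  have h3 : ((m + 1 + j + m).factorial : ℝ) ≠ 0 := by positivity
  have h4 : (m : ℝ) + 1 + j + m + 1 ≠ 0 := by positivity
  rw [normCoeff, normCoeff, h1, h2, ← add_assoc, Nat.factorial_succ, Nat.factorial_succ]
  push_cast
  field_simp
  ring

/-- The polynomial `(1 - X ^ 2) ^ m (d/dX)^m P_n (d/dX)^m P_n'`, which restricts to the product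
`P_n^m P_n'^m` on `[-1, 1]`. -/
def assocProd (n n' m : ℕ) : ℝ[X] :=
  (1 - X ^ 2) ^ m * (derivative^[m] (legendreP n) * derivative^[m] (legendreP n'))

/-- The addition theorem on the diagonal. The derivative of the left-hand side telescopes, by
Legendre's equation, so this polynomial is constant, and its value at `1` is `P_n(1) ^ 2 = 1`. -/
theorem sum_normCoeff_assocProd (n : ℕ) :
    assocProd n n 0 + 2 * ∑ m ∈ Finset.range n, C (normCoeff n (m + 1)) * assocProd n n (m + 1)
      = 1 := by
  set y : ℕ → ℝ[X] := fun m => derivative^[m] (legendreP n) with hy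
  have hd : ∀ m, derivative (y m) = y (m + 1) := fun m => by
    simp only [hy, Function.iterate_succ_apply']
  set T : ℕ → ℝ[X] := fun m => C (normCoeff n m) * (1 - X ^ 2) ^ m * y m * y (m + 1) with hT
  have hterm : ∀ m ∈ Finset.range n,
      derivative (C (normCoeff n (m + 1)) * assocProd n n (m + 1)) = T (m + 1) - T m := by
    intro m hm
    have hode := legendreP_ode n m
    have hc := congrArg (C : ℝ → ℝ[X]) (normCoeff_succ (Finset.mem_range.1 hm))
    simp only [map_mul, map_sub, map_add, map_natCast, map_one] at hc
    change (1 - X ^ 2) * y (m + 2) = 2 * ((m : ℝ[X]) + 1) * X * y (m + 1) -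
        ((n : ℝ[X]) - (m : ℝ[X])) * ((n : ℝ[X]) + (m : ℝ[X]) + 1) * y m at hode
    change derivative (C (normCoeff n (m + 1)) * ((1 - X ^ 2) ^ (m + 1) *
      (y (m + 1) * y (m + 1)))) = _
    simp only [hT, ← hc, derivative_mul, derivative_C, derivative_pow, derivative_sub,
      derivative_one, derivative_X, hd, map_ofNat, Nat.cast_ofNat, add_tsub_cancel_right,
      map_natCast]
    push_cast
    linear_combination (C (normCoeff n (m + 1)) * (1 - X ^ 2) ^ m * y (m + 1)) * hode
  have hderiv : derivative (assocProd n n 0 +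
      2 * ∑ m ∈ Finset.range n, C (normCoeff n (m + 1)) * assocProd n n (m + 1)) = 0 := by
    have h0 : derivative (assocProd n n 0) = 2 * T 0 := by
      change derivative ((1 - X ^ 2) ^ 0 * (y 0 * y 0)) = _
      simp only [hT, pow_zero, one_mul, derivative_mul, hd, normCoeff_zero, map_one]
      ring
    have hTn : T n = 0 := by
      simp only [hT, hy, iterate_derivative_legendreP_eq_zero (Nat.lt_succ_self n), mul_zero]
    rw [derivative_add, derivative_mul, derivative_sum, Finset.sum_congr rfl hterm,
      Finset.sum_range_sub, h0, hTn, derivative_ofNat]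
    ring
  rw [eq_C_of_derivative_eq_zero hderiv, coeff_zero_eq_eval_zero]
  have he := congrArg (eval 1) (eq_C_of_derivative_eq_zero hderiv)
  rw [eval_C, coeff_zero_eq_eval_zero] at he
  rw [← he]
  simp [assocProd, eval_finsetSum, eval_one_legendreP]

end Legendre

/-! ### Orthogonality of the associated Legendre functions -/
section Orthogonality
open Polynomial

/-- The mean of a polynomial over `[-1, 1]`. -/
def mean (p : ℝ[X]) : ℝ := 1 / 2 * ∫ y in (-1 : ℝ)..1, p.eval y

theorem mean_add (p q : ℝ[X]) : mean (p + q) = mean p + mean q := by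
  simp only [mean, eval_add]
  rw [intervalIntegral.integral_add (p.continuous.intervalIntegrable _ _)
    (q.continuous.intervalIntegrable _ _)]
  ring

theorem mean_C_mul (a : ℝ) (p : ℝ[X]) : mean (C a * p) = a * mean p := by
  simp only [mean, eval_mul, eval_C, intervalIntegral.integral_const_mul]
  ring

theorem mean_sum {ι : Type*} (s : Finset ι) (p : ι → ℝ[X]) :
    mean (∑ i ∈ s, p i) = ∑ i ∈ s, mean (p i) := by
  simp only [mean, eval_finsetSum]
  rw [intervalIntegral.integral_finsetSum
    fun i _ => (p i).continuous.intervalIntegrable _ _, Finset.mul_sum]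

theorem mean_one : mean 1 = 1 := by
  simp [mean]
  norm_num

theorem mean_derivative (p : ℝ[X]) :
    mean (derivative p) = 1 / 2 * (p.eval 1 - p.eval (-1)) := by
  rw [mean, intervalIntegral.integral_eq_sub_of_hasDerivAt (fun y _ => p.hasDerivAt y)
    ((derivative p).continuous.intervalIntegrable _ _)]

/-- Integrate by parts, then eliminate the second derivative by Legendre's equation. -/
theorem mean_assocProd_succ (n n' m : ℕ) :
    mean (assocProd n n' (m + 1)) = ((n : ℝ) - m) * (n + m + 1) * mean (assocProd n n' m) := by
  have hode := legendreP_ode n m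
  have key : assocProd n n' (m + 1) =
      C (((n : ℝ) - m) * (n + m + 1)) * assocProd n n' m +
        derivative ((1 - X ^ 2) ^ (m + 1) * derivative^[m + 1] (legendreP n) *
          derivative^[m] (legendreP n')) := by
    simp only [assocProd, derivative_mul, ← Function.iterate_succ_apply' (f := derivative),
      derivative_pow, derivative_one, derivative_X, Nat.cast_ofNat, map_ofNat,
      map_natCast, map_mul, map_sub, map_add, map_one, add_tsub_cancel_right]
    push_cast
    linear_combination (-(1 - X ^ 2) ^ m * derivative^[m] (legendreP n')) * hode
  rw [key, mean_add, mean_C_mul, mean_derivative]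
  simp

theorem assocProd_comm (n n' m : ℕ) : assocProd n n' m = assocProd n' n m := by
  rw [assocProd, assocProd, mul_comm (derivative^[m] (legendreP n))]

theorem mean_assocProd_of_ne {n n' : ℕ} (h : n ≠ n') (m : ℕ) : mean (assocProd n n' m) = 0 := by
  induction m with
  | zero =>
    -- By symmetry, `n (n + 1)` and `n' (n' + 1)` times the mean agree.
    have h1 := mean_assocProd_succ n n' 0
    have h2 := mean_assocProd_succ n' n 0
    rw [assocProd_comm n' n, assocProd_comm n' n, h1] at h2
    have h3 : ((n : ℝ) - n') * (n + n' + 1) * mean (assocProd n n' 0) = 0 := by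
      push_cast at h2
      linear_combination h2
    have h4 : (n : ℝ) - n' ≠ 0 := sub_ne_zero.2 (Nat.cast_injective.ne h)
    have h5 : (n : ℝ) + n' + 1 ≠ 0 := by positivity
    simpa [h4, h5] using h3
  | succ m ih => rw [mean_assocProd_succ, ih, mul_zero]

/-- After normalization, the norm of `P_n^m` does not depend on `m`. -/
theorem normCoeff_mul_mean_assocProd {n m : ℕ} (h : m ≤ n) :
    normCoeff n m * mean (assocProd n n m) = mean (assocProd n n 0) := by
  induction m with
  | zero => rw [normCoeff_zero, one_mul]
  | succ m ih =>
    rw [mean_assocProd_succ, ← mul_assoc, normCoeff_succ h, ih (by omega)]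

/-- The norm of `P_n`: all `2 n + 1` terms in the addition theorem have the same mean. -/
theorem mean_assocProd_zero (n : ℕ) : (2 * (n : ℝ) + 1) * mean (assocProd n n 0) = 1 := by
  have h := congrArg mean (sum_normCoeff_assocProd n)
  rw [← map_ofNat C 2, mean_add, mean_C_mul, mean_sum, mean_one] at h
  rw [Finset.sum_congr rfl fun m hm => by
    rw [mean_C_mul, normCoeff_mul_mean_assocProd (Finset.mem_range.1 hm)]] at h
  rw [Finset.sum_const, Finset.card_range, nsmul_eq_mul] at h
  linear_combination h

theorem natDegree_assocProd_le {n n' m : ℕ} (h : m ≤ n) (h' : m ≤ n') :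
    (assocProd n n' m).natDegree ≤ n + n' := by
  have h1 : ((1 - (X : ℝ[X]) ^ 2) ^ m).natDegree ≤ m * 2 :=
    natDegree_pow_le_of_le m (by compute_degree)
  have hd : ∀ k, (derivative^[m] (legendreP k)).natDegree ≤ k - m := fun k =>
    (natDegree_iterate_derivative _ _).trans (Nat.sub_le_sub_right (natDegree_legendreP_le k) m)
  have := natDegree_mul_le_of_le h1 (natDegree_mul_le_of_le (hd n) (hd n'))
  exact this.trans (by omega)

/-- By linearity, the quadrature formula is exact on polynomials of degree at most `z`. -/
theorem IsQuadrature.sum_eval {z r : ℕ} {x w : Fin r → ℝ} (h : IsQuadrature z x w) {p : ℝ[X]}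
    (hp : p.natDegree ≤ z) : ∑ i, w i * p.eval (x i) = mean p := by
  have he := fun y : ℝ => p.eval_eq_sum_range' (Nat.lt_succ_of_le hp) y
  simp only [mean, he, Finset.mul_sum]
  rw [intervalIntegral.integral_finsetSum fun i _ => by
    apply Continuous.intervalIntegrable; fun_prop, Finset.sum_comm, Finset.mul_sum]
  refine Finset.sum_congr rfl fun l hl => ?_
  rw [intervalIntegral.integral_const_mul, mul_left_comm,
    ← h.exact l (Nat.lt_succ_iff.1 (Finset.mem_range.1 hl)), Finset.mul_sum]
  exact Finset.sum_congr rfl fun i _ => by ring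

end Orthogonality

/-! ### Trigonometric sums over equally spaced nodes -/

/-- The nodes of `azimuthDesign α t`, in increasing order. -/
def azimuthNode (α : ℝ) (t : ℕ) (j : Fin t) : ℝ := α + 2 * Real.pi * ((j : ℕ) + 1 : ℝ) / t

theorem sum_exp_azimuthNode (α : ℝ) {t : ℕ} {k : ℤ} (hk : k ≠ 0) (hkt : |k| < t) :
    ∑ j, Complex.exp ((k * azimuthNode α t j : ℝ) * Complex.I) = 0 := by
  have ht : (t : ℂ) ≠ 0 := by
    have : t ≠ 0 := by rintro rfl; simp at hkt; exact absurd (abs_nonneg k) (not_le.2 hkt)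
    exact_mod_cast this
  set ω : ℂ := Complex.exp (2 * Real.pi * Complex.I * (k / t)) with hω
  have hterm : ∀ j : Fin t, Complex.exp ((k * azimuthNode α t j : ℝ) * Complex.I) =
      Complex.exp (k * α * Complex.I) * ω * ω ^ (j : ℕ) := by
    intro j
    rw [hω, ← Complex.exp_nat_mul, ← Complex.exp_add, ← Complex.exp_add, azimuthNode]
    congr 1
    push_cast
    field_simp
    ring
  have hω1 : ω ^ t = 1 := by
    rw [hω, ← Complex.exp_nat_mul, Complex.exp_eq_one_iff]
    exact ⟨k, by field_simp⟩
  have hωne : ω ≠ 1 := by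
    rw [hω, Ne, Complex.exp_eq_one_iff]
    rintro ⟨n, hn⟩
    have h2 : (k : ℂ) = n * t := by
      have h3 : (2 * Real.pi * Complex.I : ℂ) ≠ 0 := Complex.two_pi_I_ne_zero
      rw [mul_comm (n : ℂ)] at hn
      have := mul_left_cancel₀ h3 hn
      field_simp at this
      linear_combination this
    have h3 : k = n * t := by exact_mod_cast h2
    exact hk (Int.eq_zero_of_abs_lt_dvd ⟨n, by rw [h3, mul_comm]⟩ hkt)
  rw [Finset.sum_congr rfl fun j _ => hterm j, ← Finset.mul_sum,
    Fin.sum_univ_eq_sum_range (fun j => ω ^ j) t]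
  have := mul_neg_geom_sum ω t
  rw [hω1, sub_self, mul_eq_zero, sub_eq_zero] at this
  rw [this.resolve_left (Ne.symm hωne), mul_zero]

theorem sum_cos_azimuthNode (α : ℝ) {t : ℕ} {k : ℤ} (hk : k ≠ 0) (hkt : |k| < t) :
    ∑ j, Real.cos (k * azimuthNode α t j) = 0 := by
  simpa only [Complex.re_sum, Complex.exp_ofReal_mul_I_re, Complex.zero_re] using
    congrArg Complex.re (sum_exp_azimuthNode α hk hkt)

theorem sum_sin_azimuthNode (α : ℝ) {t : ℕ} {k : ℤ} (hkt : |k| < t) :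
    ∑ j, Real.sin (k * azimuthNode α t j) = 0 := by
  rcases eq_or_ne k 0 with rfl | hk
  · simp
  · simpa only [Complex.im_sum, Complex.exp_ofReal_mul_I_im, Complex.zero_im] using
      congrArg Complex.im (sum_exp_azimuthNode α hk hkt)

/-- The azimuthal factor of the harmonics of order `m`, scaled to have mean square one. -/
def azimuthFun (m : ℤ) (φ : ℝ) : ℝ :=
  if m = 0 then 1 else if 0 < m then √2 * Real.cos (m * φ) else √2 * Real.sin (m * φ)

/-- Discrete orthonormality: a product of two of the functions is a trigonometric polynomial of
degree less than `t`, and its mean over the nodes is its constant term. -/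
theorem sum_azimuthFun_mul (α : ℝ) {d t : ℕ} (ht : 2 * d + 1 ≤ t) {m m' : ℤ}
    (hm : |m| ≤ d) (hm' : |m'| ≤ d) :
    ∑ j, azimuthFun m (azimuthNode α t j) * azimuthFun m' (azimuthNode α t j) =
      if m = m' then (t : ℝ) else 0 := by
  have hs : √2 * √2 = (2 : ℝ) := Real.mul_self_sqrt (by norm_num)
  have hC : ∀ k : ℤ, |k| < t →
      ∑ j, Real.cos (k * azimuthNode α t j) = if k = 0 then (t : ℝ) else 0 := by
    intro k hk
    split_ifs with h
    · simp [h]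
    · exact sum_cos_azimuthNode α h hk
  have habs := abs_le.1 hm
  have habs' := abs_le.1 hm'
  have hadd : |m + m'| < t := abs_lt.2 ⟨by omega, by omega⟩
  have hsub : |m - m'| < t := abs_lt.2 ⟨by omega, by omega⟩
  have hml : |m| < t := by omega
  have hml' : |m'| < t := by omega
  have hcc : ∀ φ : ℝ, (√2 * Real.cos (m * φ)) * (√2 * Real.cos (m' * φ)) =
      Real.cos ((m - m' : ℤ) * φ) + Real.cos ((m + m' : ℤ) * φ) := fun φ => by
    push_cast
    rw [sub_mul, add_mul, Real.cos_sub, Real.cos_add]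
    linear_combination (Real.cos (m * φ) * Real.cos (m' * φ)) * hs
  have hss : ∀ φ : ℝ, (√2 * Real.sin (m * φ)) * (√2 * Real.sin (m' * φ)) =
      Real.cos ((m - m' : ℤ) * φ) - Real.cos ((m + m' : ℤ) * φ) := fun φ => by
    push_cast
    rw [sub_mul, add_mul, Real.cos_sub, Real.cos_add]
    linear_combination (Real.sin (m * φ) * Real.sin (m' * φ)) * hs
  have hsc : ∀ φ : ℝ, (√2 * Real.sin (m * φ)) * (√2 * Real.cos (m' * φ)) =
      Real.sin ((m + m' : ℤ) * φ) + Real.sin ((m - m' : ℤ) * φ) := fun φ => by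
    push_cast
    rw [sub_mul, add_mul, Real.sin_sub, Real.sin_add]
    linear_combination (Real.sin (m * φ) * Real.cos (m' * φ)) * hs
  have hcs : ∀ φ : ℝ, (√2 * Real.cos (m * φ)) * (√2 * Real.sin (m' * φ)) =
      Real.sin ((m + m' : ℤ) * φ) - Real.sin ((m - m' : ℤ) * φ) := fun φ => by
    push_cast
    rw [sub_mul, add_mul, Real.sin_sub, Real.sin_add]
    linear_combination (Real.cos (m * φ) * Real.sin (m' * φ)) * hs
  rcases lt_trichotomy m 0 with h | h | h <;> rcases lt_trichotomy m' 0 with h' | h' | h'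
  · simp only [azimuthFun, h.ne, h'.ne, h.not_gt, h'.not_gt, if_false, hss,
      Finset.sum_sub_distrib, hC _ hsub, hC _ hadd, sub_eq_zero,
      if_neg (by omega : ¬m + m' = 0), sub_zero]
  · simp [azimuthFun, h.ne, h', h.not_gt, ← Finset.mul_sum, sum_sin_azimuthNode α hml]
  · simp only [azimuthFun, h.ne, h'.ne', h.not_gt, h', if_false, if_true, hsc,
      Finset.sum_add_distrib, sum_sin_azimuthNode α hsub, sum_sin_azimuthNode α hadd,
      if_neg (by omega : ¬m = m'), add_zero]
  · simp [azimuthFun, h, h'.ne, h'.ne', h'.not_gt, ← Finset.mul_sum, sum_sin_azimuthNode α hml']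
  · simp [azimuthFun, h, h']
  · simp [azimuthFun, h, h'.ne, h'.ne', h', ← Finset.mul_sum, sum_cos_azimuthNode α h'.ne' hml']
  · simp only [azimuthFun, h.ne', h'.ne, h'.not_gt, h, if_false, if_true, hcs,
      Finset.sum_sub_distrib, sum_sin_azimuthNode α hsub, sum_sin_azimuthNode α hadd,
      if_neg (by omega : ¬m = m'), sub_zero]
  · simp [azimuthFun, h, h', h.ne', ← Finset.mul_sum, sum_cos_azimuthNode α h.ne' hml]
  · simp only [azimuthFun, h.ne', h'.ne', h, h', if_false, if_true, hcc,
      Finset.sum_add_distrib, hC _ hsub, hC _ hadd, sub_eq_zero,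
      if_neg (by omega : ¬m + m' = 0), add_zero]

/-! ### The harmonics as products of a polar and an azimuthal factor -/

/-- The polar factor of the harmonics of degree `n` and order `± m`. The factor `√2` that the
normalization has for `m ≠ 0` only is part of `azimuthFun`. -/
def polarFun (n m : ℕ) (θ : ℝ) : ℝ :=
  √((2 * n + 1) * normCoeff n m) * assocLegendre n m (Real.cos θ)

theorem sphHarm_eq_polarFun_mul_azimuthFun (n : ℕ) (m : ℤ) (θ φ : ℝ) :
    sphHarm n m θ φ = polarFun n m.natAbs θ * azimuthFun m φ := by
  have hs : √(2 * (2 * (n : ℝ) + 1) * normCoeff n m.natAbs) =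
      √2 * √((2 * n + 1) * normCoeff n m.natAbs) := by
    rw [mul_assoc, Real.sqrt_mul (by norm_num)]
  rw [normCoeff] at hs
  unfold sphHarm polarFun azimuthFun
  split_ifs with h h'
  · simp [h, normCoeff_zero]
  · rw [hs, normCoeff]
    ring
  · rw [hs, normCoeff]
    ring

theorem assocLegendre_mul_assocLegendre (n n' m : ℕ) {x : ℝ} (hx : x ^ 2 ≤ 1) :
    assocLegendre n m x * assocLegendre n' m x = (assocProd n n' m).eval x := by
  have hs : √(1 - x ^ 2) ^ 2 = 1 - x ^ 2 := Real.sq_sqrt (by linarith)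
  have h1 : ((-1 : ℝ) ^ m) ^ 2 = 1 := by rw [← pow_mul, mul_comm, pow_mul]; simp
  simp only [assocLegendre, assocProd, Polynomial.eval_mul, Polynomial.eval_pow,
    Polynomial.eval_sub, Polynomial.eval_one, Polynomial.eval_X]
  rw [show (1 - x ^ 2) ^ m = √(1 - x ^ 2) ^ (2 * m) by rw [pow_mul, hs]]
  linear_combination (√(1 - x ^ 2) ^ (2 * m) * (Polynomial.derivative^[m] (legendreP n)).eval x *
    (Polynomial.derivative^[m] (legendreP n')).eval x) * h1

theorem polarFun_mul_polarFun (n n' m : ℕ) (θ : ℝ) :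
    polarFun n m θ * polarFun n' m θ =
      √((2 * n + 1) * normCoeff n m) * √((2 * n' + 1) * normCoeff n' m) *
        (assocProd n n' m).eval (Real.cos θ) := by
  rw [← assocLegendre_mul_assocLegendre n n' m (Real.cos_sq_le_one θ), polarFun, polarFun]
  ring

theorem polarFun_sq (n m : ℕ) (θ : ℝ) :
    polarFun n m θ ^ 2 =
      (2 * n + 1) * (normCoeff n m * (assocProd n n m).eval (Real.cos θ)) := by
  have := normCoeff_pos n m
  rw [sq, polarFun_mul_polarFun, Real.mul_self_sqrt (by positivity), mul_assoc]

theorem sum_Icc_neg_eq {M : Type*} [AddCommMonoid M] (g : ℤ → M) (l : ℕ) :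
    ∑ m ∈ Finset.Icc (-(l : ℤ)) l, g m =
      g 0 + ∑ m ∈ Finset.range l, (g ((m + 1 : ℕ) : ℤ) + g (-((m + 1 : ℕ) : ℤ))) := by
  induction l with
  | zero => simp
  | succ l ih =>
    have h : Finset.Icc (-((l + 1 : ℕ) : ℤ)) ((l + 1 : ℕ) : ℤ) =
        insert ((l + 1 : ℕ) : ℤ) (insert (-((l + 1 : ℕ) : ℤ)) (Finset.Icc (-(l : ℤ)) l)) := by
      ext m
      simp only [Finset.mem_Icc, Finset.mem_insert]
      omega
    rw [h, Finset.sum_insert (by simp only [Finset.mem_Icc, Finset.mem_insert]; omega),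
      Finset.sum_insert (by simp only [Finset.mem_Icc]; omega), ih, Finset.sum_range_succ]
    abel

/-- The addition theorem at a single point of the sphere. -/
theorem sum_sphHarm_sq (l : ℕ) (θ φ : ℝ) :
    ∑ m : Order l, sphHarm l m θ φ ^ 2 = 2 * l + 1 := by
  have hs : √2 ^ 2 = (2 : ℝ) := Real.sq_sqrt (by norm_num)
  have hadd := congrArg (Polynomial.eval (Real.cos θ)) (sum_normCoeff_assocProd l)
  simp only [Polynomial.eval_add, Polynomial.eval_mul, Polynomial.eval_ofNat,
    Polynomial.eval_finsetSum, Polynomial.eval_C, Polynomial.eval_one] at hadd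
  rw [Finset.sum_coe_sort (Finset.Icc (-(l : ℤ)) l) fun m => sphHarm l m θ φ ^ 2, sum_Icc_neg_eq]
  have h0 : sphHarm l 0 θ φ ^ 2 = (2 * l + 1) * (assocProd l l 0).eval (Real.cos θ) := by
    rw [sphHarm_eq_polarFun_mul_azimuthFun, mul_pow, Int.natAbs_zero, polarFun_sq]
    simp [azimuthFun, normCoeff_zero]
  have hpair : ∀ m ∈ Finset.range l, sphHarm l ((m + 1 : ℕ) : ℤ) θ φ ^ 2 +
      sphHarm l (-((m + 1 : ℕ) : ℤ)) θ φ ^ 2 = (2 * l + 1) * (2 *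
        (normCoeff l (m + 1) * (assocProd l l (m + 1)).eval (Real.cos θ))) := by
    intro m _
    have e1 : azimuthFun ((m + 1 : ℕ) : ℤ) φ = √2 * Real.cos ((m + 1 : ℕ) * φ) := by
      rw [azimuthFun, if_neg (by omega), if_pos (by omega), Int.cast_natCast]
    have e2 : azimuthFun (-((m + 1 : ℕ) : ℤ)) φ = √2 * -Real.sin ((m + 1 : ℕ) * φ) := by
      rw [azimuthFun, if_neg (by omega), if_neg (by omega), Int.cast_neg, Int.cast_natCast,
        neg_mul, Real.sin_neg]
    rw [sphHarm_eq_polarFun_mul_azimuthFun, sphHarm_eq_polarFun_mul_azimuthFun, e1, e2,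
      Int.natAbs_neg, Int.natAbs_natCast, mul_pow, mul_pow, mul_pow, mul_pow, polarFun_sq, hs]
    linear_combination (2 * (2 * l + 1) * (normCoeff l (m + 1) *
      (assocProd l l (m + 1)).eval (Real.cos θ))) * Real.sin_sq_add_cos_sq ((m + 1 : ℕ) * φ)
  rw [Finset.sum_congr rfl hpair, h0, ← Finset.mul_sum, ← Finset.mul_sum]
  linear_combination (2 * (l : ℝ) + 1) * hadd

theorem continuous_regressionVec (d : ℕ) (a : Idx d) :
    Continuous fun z => regressionVec d z a := by
  have h : ∀ m : ℤ, Continuous (azimuthFun m) := by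
    intro m
    unfold azimuthFun
    split_ifs <;> fun_prop
  simp only [regressionVec, sphHarm_eq_polarFun_mul_azimuthFun, polarFun, assocLegendre]
  have := h a.2
  fun_prop

theorem regressionVec_sq_le (d : ℕ) (z : ℝ × ℝ) (a : Idx d) :
    regressionVec d z a ^ 2 ≤ 2 * (a.1 : ℕ) + 1 := by
  rw [← sum_sphHarm_sq (a.1 : ℕ) z.1 z.2]
  exact Finset.single_le_sum (f := fun m : Order a.1 => sphHarm a.1 m z.1 z.2 ^ 2)
    (fun m _ => sq_nonneg _) (Finset.mem_univ a.2)

/-! ### Information matrices of arbitrary designs -/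

theorem integrable_regressionVec_mul (d : ℕ) (ξ : Measure (ℝ × ℝ)) [IsFiniteMeasure ξ]
    (a b : Idx d) : Integrable (fun z => regressionVec d z a * regressionVec d z b) ξ := by
  -- The harmonics are bounded by the addition theorem, and `2 |u v| ≤ u ^ 2 + v ^ 2`.
  refine Integrable.of_bound (C := (2 * (a.1 : ℕ) + 1) + (2 * (b.1 : ℕ) + 1))
    ((continuous_regressionVec d a).mul (continuous_regressionVec d b)).aestronglyMeasurable
    (Filter.Eventually.of_forall fun z => ?_)
  have ha := regressionVec_sq_le d z a
  have hb := regressionVec_sq_le d z b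
  rw [Real.norm_eq_abs, abs_le]
  constructor <;> nlinarith [sq_nonneg (regressionVec d z a + regressionVec d z b),
    sq_nonneg (regressionVec d z a - regressionVec d z b)]

theorem posSemidef_infoMatrix (d : ℕ) (ξ : Measure (ℝ × ℝ)) [IsFiniteMeasure ξ] :
    (infoMatrix d ξ).PosSemidef := by
  refine .of_dotProduct_mulVec_nonneg (infoMatrix_isHermitian d ξ) fun v => ?_
  have h : star v ⬝ᵥ (infoMatrix d ξ).mulVec v =
      ∫ z, (∑ a, v a * regressionVec d z a) ^ 2 ∂ξ := by
    have hsq : ∀ z, (∑ a, v a * regressionVec d z a) ^ 2 =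
        ∑ a, ∑ b, v a * v b * (regressionVec d z a * regressionVec d z b) := fun z => by
      rw [sq, Finset.sum_mul_sum]
      exact Finset.sum_congr rfl fun a _ => Finset.sum_congr rfl fun b _ => by ring
    have hi : ∀ a b, Integrable
        (fun z => v a * v b * (regressionVec d z a * regressionVec d z b)) ξ :=
      fun a b => (integrable_regressionVec_mul d ξ a b).const_mul _
    simp only [hsq]
    rw [integral_finsetSum _ fun a _ => integrable_finsetSum _ fun b _ => hi a b]
    simp only [dotProduct, Matrix.mulVec, infoMatrix, Matrix.of_apply, Pi.star_apply,
      star_trivial, Finset.mul_sum]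
    refine Finset.sum_congr rfl fun a _ => ?_
    rw [integral_finsetSum _ fun b _ => hi a b]
    refine Finset.sum_congr rfl fun b _ => ?_
    rw [integral_const_mul]
    ring
  rw [h]
  exact integral_nonneg fun z => sq_nonneg _

/-- By the addition theorem, the trace of each diagonal block is the same for all designs. -/
theorem sum_infoMatrix_diag (d : ℕ) (ξ : Measure (ℝ × ℝ)) [IsProbabilityMeasure ξ]
    (l : Fin (d + 1)) :
    ∑ m : Order (l : ℕ), infoMatrix d ξ ⟨l, m⟩ ⟨l, m⟩ = Fintype.card (Order (l : ℕ)) := by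
  simp only [infoMatrix, Matrix.of_apply]
  rw [← integral_finsetSum _ fun m _ => integrable_regressionVec_mul d ξ ⟨l, m⟩ ⟨l, m⟩]
  simp only [regressionVec, ← sq, sum_sphHarm_sq, card_order]
  simp

theorem trace_infoMatrix (d : ℕ) (ξ : Measure (ℝ × ℝ)) [IsProbabilityMeasure ξ] :
    (infoMatrix d ξ).trace = ((d + 1) ^ 2 : ℕ) := by
  rw [Matrix.trace, Fintype.sum_sigma, ← card_idx, Fintype.card_sigma, Nat.cast_sum]
  exact Finset.sum_congr rfl fun l _ => sum_infoMatrix_diag d ξ l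

/-! ### The product design -/

theorem integral_polarDesign {r : ℕ} {x w : Fin r → ℝ} (hw : ∀ i, 0 ≤ w i) (g : ℝ → ℝ) :
    ∫ θ, g θ ∂polarDesign x w = ∑ i, w i * g (Real.arccos (x i)) := by
  rw [polarDesign, integral_finsetSum_measure fun i _ =>
    (integrable_dirac (by finiteness)).smul_measure ENNReal.ofReal_ne_top]
  simp [hw]

theorem integral_azimuthDesign (α : ℝ) (t : ℕ) (g : ℝ → ℝ) :
    ∫ φ, g φ ∂azimuthDesign α t = (t : ℝ)⁻¹ * ∑ j, g (azimuthNode α t j) := by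
  rcases t.eq_zero_or_pos with rfl | ht
  · simp [azimuthDesign]
  rw [azimuthDesign, integral_finsetSum_measure fun j _ =>
    (integrable_dirac (by finiteness)).smul_measure (by simp [ht.ne'])]
  simp [azimuthNode, Finset.mul_sum]

instance (α : ℝ) (t : ℕ) [NeZero t] : IsProbabilityMeasure (azimuthDesign α t) := by
  constructor
  simp [azimuthDesign, ENNReal.mul_inv_cancel, NeZero.ne]

theorem IsQuadrature.isProbabilityMeasure {z r : ℕ} {x w : Fin r → ℝ} (h : IsQuadrature z x w) :
    IsProbabilityMeasure (polarDesign x w) := by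
  constructor
  have h0 := h.exact 0 (Nat.zero_le _)
  norm_num at h0
  simp [polarDesign, ← ENNReal.ofReal_sum_of_nonneg fun i _ => (h.pos i).le, h0]

theorem IsQuadrature.isDesign_prod {z r t : ℕ} {x w : Fin r → ℝ} (h : IsQuadrature z x w)
    (ht : 0 < t) {α : ℝ} (hα : -(((t : ℝ) + 1) / t) * Real.pi < α) (hα' : α ≤ -Real.pi) :
    IsDesign ((polarDesign x w).prod (azimuthDesign α t)) := by
  have := h.isProbabilityMeasure
  have : NeZero t := ⟨ht.ne'⟩
  refine ⟨inferInstance, ?_⟩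
  have h1 : polarDesign x w (Set.Icc 0 Real.pi)ᶜ = 0 := by
    simp [polarDesign, Real.arccos_nonneg, Real.arccos_le_pi, measurableSet_Icc.compl]
  have h2 : azimuthDesign α t (Set.Ioc (-Real.pi) Real.pi)ᶜ = 0 := by
    have ht' : (0 : ℝ) < t := by exact_mod_cast ht
    have hpi := Real.pi_pos
    have hmem : ∀ j : Fin t, azimuthNode α t j ∈ Set.Ioc (-Real.pi) Real.pi := by
      intro j
      have hj : ((j : ℕ) : ℝ) + 1 ≤ t := by exact_mod_cast j.2
      have hj0 : (0 : ℝ) ≤ (j : ℕ) := Nat.cast_nonneg _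
      have e1 : -(((t : ℝ) + 1) / t) * Real.pi = -Real.pi - Real.pi / t := by
        field_simp
        ring
      have hp : 0 < Real.pi / t := by positivity
      have e2 : azimuthNode α t j = α + 2 * ((j : ℕ) + 1) * (Real.pi / t) := by
        rw [azimuthNode]
        ring
      have e3 : (t : ℝ) * (Real.pi / t) = Real.pi := by field_simp
      -- `hα` now bounds the first node from below by `-π + π / t`; the last one is `α + 2 π ≤ π`.
      rw [e1] at hα
      rw [e2]
      constructor
      · nlinarith
      · nlinarith
    have hmem' : ∀ j : Fin t, -Real.pi < α + 2 * Real.pi * ((j : ℕ) + 1 : ℝ) / t ∧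
        α + 2 * Real.pi * ((j : ℕ) + 1 : ℝ) / t ≤ Real.pi := hmem
    simp [azimuthDesign, measurableSet_Ioc.compl, hmem']
  rw [Set.compl_prod_eq_union]
  exact measure_union_null (by rw [Measure.prod_prod, h1, zero_mul])
    (by rw [Measure.prod_prod, h2, mul_zero])

theorem abs_le_of_mem_order {l : ℕ} (m : Order l) : |(m : ℤ)| ≤ l :=
  abs_le.2 (Finset.mem_Icc.1 m.2)

theorem IsQuadrature.infoMatrix_prod {d r t : ℕ} {x w : Fin r → ℝ}
    (h : IsQuadrature (2 * d) x w) (ht : 2 * d + 1 ≤ t) (α : ℝ) :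
    infoMatrix d ((polarDesign x w).prod (azimuthDesign α t)) = 1 := by
  have := h.isProbabilityMeasure
  have : NeZero t := ⟨by omega⟩
  have ht0 : (t : ℝ) ≠ 0 := NeZero.ne _
  ext ⟨l, m⟩ ⟨l', m'⟩
  have hl : (l : ℕ) ≤ d := Nat.lt_succ_iff.1 l.2
  have hl' : (l' : ℕ) ≤ d := Nat.lt_succ_iff.1 l'.2
  have hm := abs_le_of_mem_order m
  have hm' := abs_le_of_mem_order m'
  have hfac : ∀ z : ℝ × ℝ, regressionVec d z ⟨l, m⟩ * regressionVec d z ⟨l', m'⟩ =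
      (polarFun l (m : ℤ).natAbs z.1 * polarFun l' (m' : ℤ).natAbs z.1) *
        (azimuthFun m z.2 * azimuthFun m' z.2) := fun z => by
    simp only [regressionVec, sphHarm_eq_polarFun_mul_azimuthFun]
    ring
  rw [infoMatrix, Matrix.of_apply]
  simp only [hfac]
  rw [integral_prod_mul
    (fun θ => polarFun l (m : ℤ).natAbs θ * polarFun l' (m' : ℤ).natAbs θ)
    (fun φ => azimuthFun m φ * azimuthFun m' φ), integral_azimuthDesign,
    integral_polarDesign fun i => (h.pos i).le, sum_azimuthFun_mul α ht (by omega) (by omega)]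
  by_cases hmm : (m : ℤ) = m'
  · rw [if_pos hmm, inv_mul_cancel₀ ht0, mul_one, ← hmm]
    set k := (m : ℤ).natAbs with hk
    have hkl : k ≤ l := Int.ofNat_le.1 ((Int.natCast_natAbs _).trans_le hm)
    have hkl' : k ≤ l' := Int.ofNat_le.1 ((Int.natCast_natAbs _).trans_le (hmm ▸ hm'))
    have hsum : ∑ i, w i * (polarFun l k (Real.arccos (x i)) * polarFun l' k (Real.arccos (x i)))
        = √((2 * (l : ℕ) + 1) * normCoeff l k) * √((2 * (l' : ℕ) + 1) * normCoeff l' k) *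
          mean (assocProd l l' k) := by
      rw [← h.sum_eval ((natDegree_assocProd_le hkl hkl').trans (by omega)), Finset.mul_sum]
      refine Finset.sum_congr rfl fun i _ => ?_
      rw [polarFun_mul_polarFun, Real.cos_arccos (h.mem_Icc i).1 (h.mem_Icc i).2]
      ring
    rw [hsum]
    by_cases hll : l = l'
    · subst hll
      obtain rfl : m = m' := Subtype.ext hmm
      have := normCoeff_pos l k
      rw [Real.mul_self_sqrt (by positivity), mul_assoc, normCoeff_mul_mean_assocProd hkl,
        mean_assocProd_zero, Matrix.one_apply_eq]
    · rw [mean_assocProd_of_ne (fun e => hll (Fin.ext e)), mul_zero, Matrix.one_apply_ne]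
      exact fun e => hll (congrArg Sigma.fst e)
  · rw [if_neg hmm, mul_zero, mul_zero, Matrix.one_apply_ne]
    intro e
    obtain ⟨rfl, e⟩ := Sigma.mk.inj_iff.1 e
    exact hmm (congrArg Subtype.val (eq_of_heq e))

/-! ### The information matrix of a subvector of coefficients -/
section Matrix
open Matrix

variable {n ι : Type*} [Fintype n] [Fintype ι]

theorem trace_cfc [DecidableEq n] {A : Matrix n n ℝ} (hA : A.IsHermitian) (f : ℝ → ℝ) :
    (cfc f A).trace = ∑ i, f (hA.eigenvalues i) := by
  rw [hA.cfc_eq, Matrix.IsHermitian.cfc, Unitary.conjStarAlgAut_apply, trace_mul_cycle,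
    Unitary.coe_star_mul_self, one_mul]
  simp [trace]

theorem trace_inv_eq_sum [DecidableEq n] {A : Matrix n n ℝ} (hA : A.PosDef) :
    A⁻¹.trace = ∑ i, (hA.isHermitian.eigenvalues i)⁻¹ := by
  rw [← trace_cfc hA.isHermitian, Matrix.nonsing_inv_eq_ringInverse]
  obtain ⟨u, rfl⟩ := hA.isUnit
  rw [Ring.inverse_unit, cfc_inv_id (R := ℝ) u hA.isHermitian.isSelfAdjoint]

/-- If `range K ⊆ range M`, then `K = M Z` for some `Z`, and `M M⁻ M = M` gives
`Kᵀ M⁻ K = Zᵀ M Z`. -/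
theorem exists_mul_eq_and_transpose_mul_genInv_mul [DecidableEq n] {M : Matrix n n ℝ}
    (hM : M.IsHermitian) {K : Matrix n ι ℝ}
    (hK : LinearMap.range K.mulVecLin ≤ LinearMap.range M.mulVecLin) :
    ∃ Z : Matrix n ι ℝ, M * Z = K ∧ Kᵀ * genInv M * K = Zᵀ * M * Z := by
  classical
  have hcol : ∀ j, ∃ z, M.mulVec z = K.col j := fun j => by
    obtain ⟨z, hz⟩ := hK ⟨Pi.single j 1, rfl⟩
    exact ⟨z, by simpa using hz⟩
  choose z hz using hcol
  have hZ : M * (Matrix.of z)ᵀ = K := by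
    ext i j
    exact congrFun (hz j) i
  refine ⟨(Matrix.of z)ᵀ, hZ, ?_⟩
  have hG : M * genInv M * M = M := (exists_genInv M).choose_spec
  have hMt : Mᵀ = M := by simpa [conjTranspose_eq_transpose_of_trivial] using hM.eq
  generalize (Matrix.of z)ᵀ = Z at hZ
  rw [← hZ, transpose_mul, hMt]
  calc Zᵀ * M * genInv M * (M * Z) = Zᵀ * (M * genInv M * M) * Z := by
        simp only [Matrix.mul_assoc]
    _ = _ := by rw [hG]

variable [DecidableEq n] [DecidableEq ι] {M : Matrix n n ℝ} {K : Matrix n ι ℝ}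

theorem posDef_transpose_mul_genInv_mul (hM : M.PosSemidef) (hKK : Kᵀ * K = 1)
    (hK : LinearMap.range K.mulVecLin ≤ LinearMap.range M.mulVecLin) :
    (Kᵀ * genInv M * K).PosDef := by
  obtain ⟨Z, hZ, hA⟩ := exists_mul_eq_and_transpose_mul_genInv_mul hM.isHermitian hK
  have hpsd : (Zᵀ * M * Z).PosSemidef := by
    simpa [conjTranspose_eq_transpose_of_trivial] using hM.conjTranspose_mul_mul_same Z
  rw [hA]
  refine .of_dotProduct_mulVec_pos hpsd.isHermitian fun v hv => ?_
  refine lt_of_le_of_ne (hpsd.dotProduct_mulVec_nonneg v) fun h0 => hv ?_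
  have h1 : star (Z *ᵥ v) ⬝ᵥ M *ᵥ (Z *ᵥ v) = 0 := by
    rw [h0, ← mulVec_mulVec, ← mulVec_mulVec, dotProduct_mulVec _ Zᵀ, star_trivial, star_trivial,
      vecMul_transpose]
  have h2 := (hM.dotProduct_mulVec_zero_iff _).1 h1
  rw [mulVec_mulVec, hZ] at h2
  rw [← one_mulVec v, ← hKK, ← mulVec_mulVec, h2, mulVec_zero]

/-- `(Kᵀ M⁻ K)⁻¹ ≤ Kᵀ M K` when the columns of `K` are orthonormal: with `A = Kᵀ M⁻ K` and
`M Z = K` the difference is `Wᵀ M W` for `W = K - Z A⁻¹`. -/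
theorem posSemidef_sub_inv_transpose_mul_genInv_mul (hM : M.PosSemidef) (hKK : Kᵀ * K = 1)
    (hK : LinearMap.range K.mulVecLin ≤ LinearMap.range M.mulVecLin) :
    (Kᵀ * M * K - (Kᵀ * genInv M * K)⁻¹).PosSemidef := by
  have hpd := posDef_transpose_mul_genInv_mul hM hKK hK
  obtain ⟨Z, hZ, hA⟩ := exists_mul_eq_and_transpose_mul_genInv_mul hM.isHermitian hK
  rw [hA] at hpd ⊢
  set A := Zᵀ * M * Z with hAdef
  have hMt : Mᵀ = M := by
    simpa [conjTranspose_eq_transpose_of_trivial] using hM.isHermitian.eq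
  have hAt : Aᵀ = A := by
    simpa [conjTranspose_eq_transpose_of_trivial] using hpd.isHermitian.eq
  have hZt : Zᵀ * M = Kᵀ := by rw [← hZ, transpose_mul, hMt]
  have hAA : A * A⁻¹ = 1 := mul_nonsing_inv A ((isUnit_iff_isUnit_det A).1 hpd.isUnit)
  have h := hM.conjTranspose_mul_mul_same (K - Z * A⁻¹)
  rw [conjTranspose_eq_transpose_of_trivial, transpose_sub, transpose_mul, transpose_nonsing_inv,
    hAt] at h
  have e : (Kᵀ - A⁻¹ * Zᵀ) * M * (K - Z * A⁻¹) = Kᵀ * M * K - A⁻¹ := by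
    have e1 : Kᵀ * M * (Z * A⁻¹) = A⁻¹ := by
      rw [Matrix.mul_assoc, ← Matrix.mul_assoc M, hZ, ← Matrix.mul_assoc, hKK, Matrix.one_mul]
    have e2 : A⁻¹ * Zᵀ * M * K = A⁻¹ := by
      rw [Matrix.mul_assoc A⁻¹, hZt, Matrix.mul_assoc, hKK, Matrix.mul_one]
    have e3 : A⁻¹ * Zᵀ * M * (Z * A⁻¹) = A⁻¹ := by
      rw [show A⁻¹ * Zᵀ * M * (Z * A⁻¹) = A⁻¹ * (Zᵀ * M * Z * A⁻¹) by
        simp only [Matrix.mul_assoc], ← hAdef, hAA, Matrix.mul_one]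
    rw [Matrix.sub_mul, Matrix.sub_mul, Matrix.mul_sub, Matrix.mul_sub, e1, e2, e3]
    abel
  rwa [e] at h

end Matrix

theorem transpose_selectMatrix_mul_mul {d q : ℕ} {k : Fin (q + 1) → Fin (d + 1)}
    (M : Matrix (Idx d) (Idx d) ℝ) :
    (selectMatrix k).transpose * M * selectMatrix k =
      M.submatrix (fun b => ⟨k b.1, b.2⟩) (fun b => ⟨k b.1, b.2⟩) := by
  ext a b
  simp [selectMatrix, Matrix.mul_apply]

theorem transpose_selectMatrix_mul_self {d q : ℕ} {k : Fin (q + 1) → Fin (d + 1)}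
    (hk : Function.Injective k) : (selectMatrix k).transpose * selectMatrix k = 1 := by
  have h := transpose_selectMatrix_mul_mul (k := k) 1
  rw [Matrix.mul_one] at h
  rw [h]
  refine Matrix.submatrix_one _ ?_
  rintro ⟨i, m⟩ ⟨i', m'⟩ h
  obtain ⟨h1, h2⟩ := Sigma.mk.inj_iff.1 h
  obtain rfl := hk h1
  exact Sigma.ext rfl h2

theorem trace_transpose_selectMatrix_mul_mul {d q : ℕ} (k : Fin (q + 1) → Fin (d + 1))
    (ξ : Measure (ℝ × ℝ)) [IsProbabilityMeasure ξ] :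
    ((selectMatrix k).transpose * infoMatrix d ξ * selectMatrix k).trace =
      Fintype.card (Σ i : Fin (q + 1), Order (k i : ℕ)) := by
  rw [transpose_selectMatrix_mul_mul, Matrix.trace, Fintype.sum_sigma, Fintype.card_sigma,
    Nat.cast_sum]
  exact Finset.sum_congr rfl fun i _ => sum_infoMatrix_diag d ξ (k i)

/-! ### Power means of numbers with mean at most one -/
section PowerMeans

/-- Bernoulli's inequality for exponents in `[0, 1]`. -/
theorem rpow_le_one_add_mul {x p : ℝ} (hx : 0 ≤ x) (hp : 0 ≤ p) (hp1 : p ≤ 1) :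
    x ^ p ≤ 1 + p * (x - 1) := by
  simpa using rpow_one_add_le_one_add_mul_self (s := x - 1) (by linarith) hp hp1

/-- Bernoulli's inequality for nonpositive exponents. -/
theorem one_add_mul_le_rpow_of_nonpos {x p : ℝ} (hx : 0 < x) (hp : p ≤ 0) :
    1 + p * (x - 1) ≤ x ^ p := by
  rw [Real.rpow_def_of_pos hx]
  have h1 := Real.add_one_le_exp (Real.log x * p)
  have h2 := Real.log_le_sub_one_of_pos hx
  nlinarith

variable {ι : Type*} {s : Finset ι} {c : ι → ℝ}

theorem sum_rpow_le_card {p : ℝ} (hp : 0 ≤ p) (hp1 : p ≤ 1) (hc : ∀ i ∈ s, 0 ≤ c i)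
    (hs : ∑ i ∈ s, c i ≤ s.card) : ∑ i ∈ s, c i ^ p ≤ s.card := by
  calc ∑ i ∈ s, c i ^ p ≤ ∑ i ∈ s, (1 + p * (c i - 1)) :=
        Finset.sum_le_sum fun i hi => rpow_le_one_add_mul (hc i hi) hp hp1
    _ = s.card + p * (∑ i ∈ s, c i - s.card) := by
        simp [Finset.sum_add_distrib, ← Finset.mul_sum]
    _ ≤ s.card := by nlinarith

theorem card_le_sum_rpow {p : ℝ} (hp : p ≤ 0) (hc : ∀ i ∈ s, 0 < c i)
    (hs : ∑ i ∈ s, c i ≤ s.card) : s.card ≤ ∑ i ∈ s, c i ^ p := by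
  calc (s.card : ℝ) ≤ s.card + p * (∑ i ∈ s, c i - s.card) := by nlinarith
    _ = ∑ i ∈ s, (1 + p * (c i - 1)) := by
        simp [Finset.sum_add_distrib, ← Finset.mul_sum]
    _ ≤ ∑ i ∈ s, c i ^ p :=
        Finset.sum_le_sum fun i hi => one_add_mul_le_rpow_of_nonpos (hc i hi) hp

theorem prod_le_one_of_sum_le_card (hc : ∀ i ∈ s, 0 ≤ c i) (hs : ∑ i ∈ s, c i ≤ s.card) :
    ∏ i ∈ s, c i ≤ 1 := by
  calc ∏ i ∈ s, c i ≤ ∏ i ∈ s, Real.exp (c i - 1) :=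
        Finset.prod_le_prod hc fun i _ => by linarith [Real.add_one_le_exp (c i - 1)]
    _ = Real.exp (∑ i ∈ s, c i - s.card) := by
        rw [← Real.exp_sum]
        simp
    _ ≤ 1 := Real.exp_le_one_iff.2 (by linarith)

theorem rpow_sum_rpow_le_card {p : ℝ} (hp0 : p ≠ 0) (hp1 : p ≤ 1) (hn : s.Nonempty)
    (hc : ∀ i ∈ s, 0 < c i) (hs : ∑ i ∈ s, c i ≤ s.card) :
    (∑ i ∈ s, c i ^ p) ^ (1 / p) ≤ (s.card : ℝ) ^ (1 / p) := by
  have hcard : (0 : ℝ) < s.card := by exact_mod_cast hn.card_pos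
  rcases hp0.lt_or_gt with h | h
  · exact Real.rpow_le_rpow_of_nonpos hcard (card_le_sum_rpow h.le hc hs)
      (one_div_neg.2 h).le
  · exact Real.rpow_le_rpow (Finset.sum_nonneg fun i hi => Real.rpow_nonneg (hc i hi).le _)
      (sum_rpow_le_card h.le hp1 (fun i hi => (hc i hi).le) hs) (one_div_pos.2 h).le

end PowerMeans

/-! ### Optimality -/

theorem genInv_one {n : Type*} [Fintype n] [DecidableEq n] : genInv (1 : Matrix n n ℝ) = 1 := by
  have h : (1 : Matrix n n ℝ) * genInv 1 * 1 = 1 := (exists_genInv 1).choose_spec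
  rwa [Matrix.one_mul, Matrix.mul_one] at h

theorem toReal_lt_one {p : EReal} (hp : p < 1) (hbot : p ≠ ⊥) : p.toReal < 1 := by
  lift p to ℝ using ⟨(hp.trans_le le_top).ne, hbot⟩
  exact_mod_cast hp

theorem toReal_ne_zero {p : EReal} (hp : p < 1) (hbot : p ≠ ⊥) (h0 : p ≠ 0) : p.toReal ≠ 0 := by
  lift p to ℝ using ⟨(hp.trans_le le_top).ne, hbot⟩
  exact_mod_cast h0

/-- The value of `Φ_p`, for an `n`-dimensional subvector, at a design whose information matrix is
the identity. -/
def phiIdentity (p : EReal) (n : ℕ) : ℝ :=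
  if p = ⊥ then 1 else if p = 0 then 1 else (n : ℝ) ^ (1 / p.toReal)

theorem phi_eq_phiIdentity {d : ℕ} {ι : Type*} [Fintype ι] [DecidableEq ι] [Nonempty ι]
    {K : Matrix (Idx d) ι ℝ} (hKK : K.transpose * K = 1) {ξ : Measure (ℝ × ℝ)}
    (hξ : infoMatrix d ξ = 1) (p : EReal) : Phi p K ξ = phiIdentity p (Fintype.card ι) := by
  have hA : K.transpose * genInv (infoMatrix d ξ) * K = 1 := by
    rw [hξ, genInv_one, Matrix.mul_one, hKK]
  simp only [Phi, phiIdentity, hA, inv_one, Matrix.det_one, spectrum.one_eq, csInf_singleton,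
    cfc_apply_one, Real.one_rpow, map_one, Matrix.trace_one]

theorem phi_le_phiIdentity {d : ℕ} {ι : Type*} [Fintype ι] [DecidableEq ι] [Nonempty ι]
    {K : Matrix (Idx d) ι ℝ} (hKK : K.transpose * K = 1) {ξ : Measure (ℝ × ℝ)}
    [IsFiniteMeasure ξ] (hK : Estimable K ξ)
    (htr : (K.transpose * infoMatrix d ξ * K).trace ≤ Fintype.card ι) {p : EReal} (hp : p < 1) :
    Phi p K ξ ≤ phiIdentity p (Fintype.card ι) := by
  have hM := posSemidef_infoMatrix d ξ
  have hA := posDef_transpose_mul_genInv_mul hM hKK hK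
  have hsub := (posSemidef_sub_inv_transpose_mul_genInv_mul hM hKK hK).trace_nonneg
  rw [Matrix.trace_sub] at hsub
  simp only [Phi, phiIdentity]
  set A := K.transpose * genInv (infoMatrix d ξ) * K
  have hle : A⁻¹.trace ≤ (Finset.univ : Finset ι).card := by
    rw [Finset.card_univ]
    linarith
  have hle' := hle
  rw [trace_inv_eq_sum hA] at hle'
  have hpos : ∀ i ∈ Finset.univ, 0 < (hA.isHermitian.eigenvalues i)⁻¹ :=
    fun i _ => inv_pos.2 (hA.eigenvalues_pos i)
  split_ifs with hbot h0
  -- `p = -∞`: some eigenvalue is at most the mean of the eigenvalues.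
  · have hH := hA.inv.isHermitian
    rw [hH.trace_eq_sum_eigenvalues] at hle
    obtain ⟨i, -, hi⟩ : ∃ i ∈ Finset.univ, hH.eigenvalues i ≤ 1 :=
      Finset.exists_le_of_sum_le Finset.univ_nonempty (by simpa using hle)
    exact (csInf_le Matrix.finite_real_spectrum.bddBelow
      (hH.eigenvalues_mem_spectrum_real i)).trans hi
  · rw [Matrix.det_nonsing_inv, hA.isHermitian.det_eq_prod_eigenvalues, Ring.inverse_eq_inv']
    simpa using prod_le_one_of_sum_le_card (fun i hi => (hpos i hi).le) hle'
  · have h := rpow_sum_rpow_le_card (toReal_ne_zero hp hbot h0) (toReal_lt_one hp hbot).le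
      Finset.univ_nonempty hpos hle'
    rw [trace_cfc hA.isHermitian]
    refine le_trans (le_of_eq ?_) h
    congr 1
    refine Finset.sum_congr rfl fun i _ => ?_
    rw [Real.rpow_neg (hA.eigenvalues_pos i).le, Real.inv_rpow (hA.eigenvalues_pos i).le]

theorem isPhiOptimal_of_infoMatrix_eq_one {d q : ℕ} {ξ : Measure (ℝ × ℝ)} (hd : IsDesign ξ)
    (hξ : infoMatrix d ξ = 1) {p : EReal} (hp : p < 1) {k : Fin (q + 1) → Fin (d + 1)}
    (hk : Function.Injective k) : IsPhiOptimal p (selectMatrix k) ξ := by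
  have hKK := transpose_selectMatrix_mul_self hk
  have : Nonempty (Σ i : Fin (q + 1), Order (k i : ℕ)) := ⟨0, 0, by simp⟩
  refine ⟨hd, ?_, fun η hη hK => ?_⟩
  · rw [Estimable, hξ, Matrix.mulVecLin_one, LinearMap.range_id]
    exact le_top
  · have := hη.prob
    rw [phi_eq_phiIdentity hKK hξ]
    exact phi_le_phiIdentity hKK hK (trace_transpose_selectMatrix_mul_mul k η).le hp

theorem sortedEig_monotone (d : ℕ) (ξ : Measure (ℝ × ℝ)) : Monotone (sortedEig d ξ) := by
  intro i j hij
  refine (infoMatrix_isHermitian d ξ).eigenvalues₀_antitone ?_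
  simpa [Fin.le_def] using Fin.rev_le_rev.2 hij

theorem sum_eigenvalues₀ {n : Type*} [Fintype n] [DecidableEq n] {A : Matrix n n ℝ}
    (hA : A.IsHermitian) : ∑ i, hA.eigenvalues₀ i = A.trace := by
  rw [hA.trace_eq_sum_eigenvalues]
  simp only [Matrix.IsHermitian.eigenvalues]
  exact (Equiv.sum_comp _ hA.eigenvalues₀).symm

theorem exists_eigenvalues_eq_sortedEig (d : ℕ) (ξ : Measure (ℝ × ℝ)) (j : Fin ((d + 1) ^ 2)) :
    ∃ a, (infoMatrix_isHermitian d ξ).eigenvalues a = sortedEig d ξ j := by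
  refine ⟨Fintype.equivOfCardEq (Fintype.card_fin _) (Fin.cast (card_idx d).symm (Fin.rev j)), ?_⟩
  simp [Matrix.IsHermitian.eigenvalues, sortedEig]

theorem sortedEig_nonneg (d : ℕ) (ξ : Measure (ℝ × ℝ)) [IsFiniteMeasure ξ]
    (j : Fin ((d + 1) ^ 2)) : 0 ≤ sortedEig d ξ j := by
  obtain ⟨a, ha⟩ := exists_eigenvalues_eq_sortedEig d ξ j
  rw [← ha]
  exact (posSemidef_infoMatrix d ξ).eigenvalues_nonneg a

theorem sum_sortedEig (d : ℕ) (ξ : Measure (ℝ × ℝ)) [IsProbabilityMeasure ξ] :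
    ∑ j, sortedEig d ξ j = ((d + 1) ^ 2 : ℕ) := by
  rw [← trace_infoMatrix d ξ, ← sum_eigenvalues₀ (infoMatrix_isHermitian d ξ)]
  exact Equiv.sum_comp (Fin.revPerm.trans (finCongr (card_idx d).symm))
    (infoMatrix_isHermitian d ξ).eigenvalues₀

theorem sortedEig_eq_one {d : ℕ} {ξ : Measure (ℝ × ℝ)} (hξ : infoMatrix d ξ = 1)
    (j : Fin ((d + 1) ^ 2)) : sortedEig d ξ j = 1 := by
  obtain ⟨a, ha⟩ := exists_eigenvalues_eq_sortedEig d ξ j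
  have h := (infoMatrix_isHermitian d ξ).eigenvalues_mem_spectrum_real a
  have : Nonempty (Idx d) := ⟨a⟩
  rw [ha, hξ, spectrum.one_eq] at h
  exact h

theorem card_filter_val_lt {N s : ℕ} (hs : s ≤ N) :
    (Finset.univ.filter fun j : Fin N => (j : ℕ) < s).card = s := by
  rw [Fin.card_filter_val_lt, min_eq_right hs]

/-- If the numbers `f 0 ≤ f 1 ≤ …` have mean at most one, so do the `s` smallest of them. -/
theorem sum_filter_val_lt_le {N s : ℕ} (hs : s ≤ N) {f : Fin N → ℝ} (hf : Monotone f)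
    (hsum : ∑ j, f j ≤ N) : ∑ j with j.val < s, f j ≤ s := by
  by_cases h : ∀ j : Fin N, (j : ℕ) < s → f j ≤ 1
  · calc ∑ j with j.val < s, f j ≤ ∑ j : Fin N with j.val < s, (1 : ℝ) :=
          Finset.sum_le_sum fun j hj => h j (Finset.mem_filter.1 hj).2
      _ = s := by rw [Finset.sum_const, card_filter_val_lt hs, nsmul_one]
  -- Otherwise every term outside the sum exceeds `1`, and these have sum at least `N - s`.
  · push Not at h
    obtain ⟨i, hi, hi1⟩ := h
    have hsplit := Finset.sum_filter_add_sum_filter_not Finset.univ (fun j : Fin N => j.val < s) f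
    have hcard := Finset.card_filter_add_card_filter_not (s := Finset.univ)
      (fun j : Fin N => j.val < s)
    rw [card_filter_val_lt hs, Finset.card_univ, Fintype.card_fin] at hcard
    have hcard' : (s : ℝ) + (Finset.univ.filter fun j : Fin N => ¬j.val < s).card = N := by
      exact_mod_cast hcard
    have hge : ((Finset.univ.filter fun j : Fin N => ¬j.val < s).card : ℝ) ≤
        ∑ j with ¬j.val < s, f j := by
      rw [← nsmul_one, ← Finset.sum_const]
      refine Finset.sum_le_sum fun j hj => hi1.le.trans (hf ?_)
      have := (Finset.mem_filter.1 hj).2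
      exact Fin.le_def.2 (by omega)
    linarith

theorem isPsiOptimal_of_infoMatrix_eq_one {d s : ℕ} {ξ : Measure (ℝ × ℝ)} (hd : IsDesign ξ)
    (hξ : infoMatrix d ξ = 1) {p : EReal} (hp : p < 1) (hs1 : 1 ≤ s) (hs : s ≤ (d + 1) ^ 2) :
    IsPsiOptimal d p s ξ := by
  refine ⟨hd, fun η hη => ?_⟩
  have := hη.prob
  set F := Finset.univ.filter fun j : Fin ((d + 1) ^ 2) => (j : ℕ) < s with hF
  have hFs : F.card = s := card_filter_val_lt hs
  have hmono := sortedEig_monotone d η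
  have hnn := sortedEig_nonneg d η
  have htot := (sum_sortedEig d η).le
  have hsum : ∑ j ∈ F, sortedEig d η j ≤ F.card := by
    rw [hFs]
    exact sum_filter_val_lt_le hs hmono htot
  simp only [Psi, sortedEig_eq_one hξ, ← hF]
  split_ifs with hbot h0
  · refine ENNReal.ofReal_le_ofReal ?_
    simpa [Finset.filter_eq'] using
      sum_filter_val_lt_le (s := 1) (hs1.trans hs) hmono htot
  · rw [← ENNReal.ofReal_prod_of_nonneg fun j _ => hnn j]
    simpa using prod_le_one_of_sum_le_card (fun j _ => hnn j) hsum
  · have hp0 := toReal_ne_zero hp hbot h0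
    have hp1 := (toReal_lt_one hp hbot).le
    simp only [ENNReal.ofReal_one, ENNReal.one_rpow, Finset.sum_const, nsmul_one]
    rcases hp0.lt_or_gt with hneg | hpos
    · rw [← neg_neg (1 / p.toReal), ENNReal.rpow_neg, ENNReal.rpow_neg _ (-(1 / p.toReal)),
        ENNReal.inv_le_inv]
      refine ENNReal.rpow_le_rpow ?_ (neg_nonneg.2 (one_div_neg.2 hneg).le)
      -- If an eigenvalue vanishes, the sum is `∞` because `0 ^ p = ∞` for `p < 0` in `ℝ≥0∞`.
      by_cases hz : ∃ j ∈ F, sortedEig d η j = 0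
      · obtain ⟨j, hj, hj0⟩ := hz
        refine le_trans ?_ (Finset.single_le_sum (fun _ _ => zero_le) hj)
        simp [hj0, ENNReal.zero_rpow_of_neg hneg]
      · push Not at hz
        have hpos : ∀ j ∈ F, 0 < sortedEig d η j := fun j hj => (hnn j).lt_of_ne' (hz j hj)
        have h := ENNReal.ofReal_le_ofReal (card_le_sum_rpow hneg.le hpos hsum)
        rw [ENNReal.ofReal_sum_of_nonneg fun j _ => Real.rpow_nonneg (hnn j) _,
          ENNReal.ofReal_natCast] at h
        refine h.trans_eq (Finset.sum_congr rfl fun j hj => ?_)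
        rw [ENNReal.ofReal_rpow_of_pos (hpos j hj)]
    · refine ENNReal.rpow_le_rpow ?_ (one_div_pos.2 hpos).le
      have h := ENNReal.ofReal_le_ofReal (sum_rpow_le_card hpos.le hp1 (fun j _ => hnn j) hsum)
      rw [ENNReal.ofReal_sum_of_nonneg fun j _ => Real.rpow_nonneg (hnn j) _,
        ENNReal.ofReal_natCast] at h
      refine le_trans (le_of_eq (Finset.sum_congr rfl fun j hj => ?_)) h
      rw [ENNReal.ofReal_rpow_of_nonneg (hnn j) hpos.le]

end SphericalDesign
end

open SphericalDesign
theorem theorem3p2 (d r t : ℕ) (hr : d + 1 ≤ r) (hr' : r ≤ 2 * d) (ht : 2 * d + 1 ≤ t)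
    (x w : Fin r → ℝ) (hxw : IsQuadrature (2 * d) x w)
    (α : ℝ) (hα : -(((t : ℝ) + 1) / t) * Real.pi < α) (hα' : α ≤ -Real.pi) :
    infoMatrix d ((polarDesign x w).prod (azimuthDesign α t)) = 1 ∧
    (∀ p : EReal, p < 1 → ∀ (q : ℕ) (k : Fin (q + 1) → Fin (d + 1)), StrictMono k →
      IsPhiOptimal p (selectMatrix k) ((polarDesign x w).prod (azimuthDesign α t))) ∧
    (∀ p : EReal, p < 1 → ∀ s : ℕ, 1 ≤ s → s ≤ (d + 1) ^ 2 →
      IsPsiOptimal d p s ((polarDesign x w).prod (azimuthDesign α t))) := by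
  have hM := hxw.infoMatrix_prod ht α
  have hD := hxw.isDesign_prod (by omega) hα hα'
  exact ⟨hM, fun p hp q k hk => isPhiOptimal_of_infoMatrix_eq_one hD hM hp hk.injective,
    fun p hp s hs1 hs => isPsiOptimal_of_infoMatrix_eq_one hD hM hp hs1 hs⟩
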